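/- Let $g$ be a finite simple undirected graph whose girth (the minimum length of a cycle in $g$, equal to $\infty$ if $g$ has no cycles) is at least $5$. Let $\overrightarrow{g}$ be its symmetric digraph, which has the same vertex set and in which every edge of $g$ is oriented in both directions. Then the reduced path homology with integer coefficients satisfies $$\tilde H_k(\overrightarrow{g}) = 0 \qquad \text{for every } k \ge 2.$$ Here, for a digraph $G$ with vertex set $V$ and edge set $E\subset\{(x,y)\in V\times V : x\neq y\}$, the groups $\tilde H_k(G)$ are defined as follows. For $k\ge -1$ let $\Lambda_k$ be the free abelian group on all $(k+1)$-tuples $(x_0,\dots,x_k)$ of vertices (with one empty tuple for $k=-1$), with boundary $\partial (x_0,\dots,x_k)=\sum_{i=0}^{k}(-1)^i(x_0,\dots,\widehat{x_i},\dots,x_k)$. Let $R_k$ be the quotient of $\Lambda_k$ by the subgroup generated by the tuples with $x_i=x_{i+1}$ for some $i$; the boundary descends to $\partial:R_k\to R_{k-1}$. Put $\Lambda_k=R_k=0$ for $k\le -2$. Let $A_k(G)\subset R_k$ be the subgroup generated by the tuples with $(x_i,x_{i+1})\in E$ for all $0\le i\le k-1$, and let $\Omega_k(G)=\{c\in A_k(G)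 : \partial c\in A_{k-1}(G)\}$. Then $(\Omega_*(G),\partial)$ is a chain complex, and $\tilde H_k(G)$ is its $k$-th homology group. -/

import Mathlib

universe u

/-- The symmetric digraph of an undirected graph `g`: same vertices, and each edge of `g` is
oriented in both directions. -/
def SimpleGraph.symmDigraph {V : Type u} (g : SimpleGraph V) : Digraph V where
  Adj x y := g.Adj x y

namespace PathHomology

/-!
Indexing: an elementary `k`-path `(x_0, …, x_k)` is a tuple of `n = k + 1` vertices, so everything
below is indexed by the number `n : ℕ` of vertices.  Thus `n = 0` is the augmentation degree
`k = -1`, where there is exactly one (empty) tuple, and degree `k` corresponds to `n = k + 1`.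
-/

/-- `Λ_{n-1}`: the free abelian group on all `n`-tuples of vertices. -/
abbrev Chains (V : Type u) (n : ℕ) : Type u := (Fin n → V) →₀ ℤ

/-- The boundary `(x_0, …, x_n) ↦ ∑ i, (-1)^i (x_0, …, x_i omitted, …, x_n)`. -/
noncomputable def boundary (V : Type u) (n : ℕ) : Chains V (n + 1) →ₗ[ℤ] Chains V n :=
  Finsupp.linearCombination ℤ fun x : Fin (n + 1) → V =>
    ∑ i : Fin (n + 1), (-1 : ℤ) ^ (i : ℕ) • Finsupp.single (i.removeNth x) (1 : ℤ)

theorem boundary_single {V : Type u} {n : ℕ} (x : Fin (n + 1) → V) :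
    boundary V n (Finsupp.single x 1) =
      ∑ i : Fin (n + 1), (-1 : ℤ) ^ (i : ℕ) • Finsupp.single (i.removeNth x) (1 : ℤ) := by
  simp [boundary]

theorem neg_one_pow_swap {n : ℕ} (i : Fin (n + 2)) (j : Fin (n + 1)) :
    (-1 : ℤ) ^ ((i.succAbove j : ℕ) + (j.predAbove i : ℕ)) = -(-1 : ℤ) ^ ((i : ℕ) + (j : ℕ)) := by
  have key : ((i.succAbove j : ℕ) + (j.predAbove i : ℕ)) + 1 = (i : ℕ) + j ∨
      ((i.succAbove j : ℕ) + (j.predAbove i : ℕ)) = ((i : ℕ) + j) + 1 := by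
    rcases lt_or_ge j.castSucc i with h | h
    · rw [Fin.succAbove_of_castSucc_lt _ _ h, Fin.predAbove_of_castSucc_lt _ _ h]
      have : (j : ℕ) < i := h
      simp only [Fin.val_castSucc, Fin.val_pred]
      omega
    · rw [Fin.succAbove_of_le_castSucc _ _ h, Fin.predAbove_of_le_castSucc _ _ h]
      have : (i : ℕ) ≤ j := h
      simp only [Fin.val_succ, Fin.coe_castPred]
      omega
  rcases key with h | h
  · rw [← h, pow_succ]; ring
  · rw [h, pow_succ]; ring

theorem boundary_boundary (V : Type u) (n : ℕ) (c : Chains V (n + 2)) :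
    boundary V n (boundary V (n + 1) c) = 0 := by
  suffices h : (boundary V n) ∘ₗ (boundary V (n + 1)) = 0 from LinearMap.congr_fun h c
  refine Finsupp.lhom_ext' fun x => LinearMap.ext_ring ?_
  simp only [LinearMap.comp_apply, Finsupp.lsingle_apply, LinearMap.zero_apply, boundary_single,
    map_sum, map_smul, Finset.smul_sum, smul_smul, ← pow_add]
  rw [← Fintype.sum_prod_type']
  refine Finset.sum_involution (fun p _ => (p.1.succAbove p.2, p.2.predAbove p.1)) ?_ ?_ ?_ ?_
  · rintro ⟨i, j⟩ -
    dsimp only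
    rw [← Fin.removeNth_removeNth_eq_swap x j i, neg_one_pow_swap, neg_smul, add_neg_cancel]
  · rintro ⟨i, j⟩ - - h
    exact Fin.succAbove_ne i j (Prod.ext_iff.mp h).1
  · intro _ _; simp
  · rintro ⟨i, j⟩ -
    exact Prod.ext (Fin.succAbove_succAbove_predAbove i j)
      (Fin.predAbove_predAbove_succAbove i j)

/-- A tuple is degenerate if two consecutive vertices coincide. -/
def Degenerate {V : Type u} {n : ℕ} (x : Fin n → V) : Prop :=
  ∃ i j : Fin n, (j : ℕ) = i + 1 ∧ x i = x j

/-- `I_{n-1}`: the subgroup of `Λ_{n-1}` generated by the degenerate tuples. -/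
noncomputable def degenerateChains (V : Type u) (n : ℕ) : Submodule ℤ (Chains V n) :=
  Submodule.span ℤ {c | ∃ x : Fin n → V, Degenerate x ∧ c = Finsupp.single x 1}

theorem boundary_degenerate (V : Type u) (n : ℕ) :
    degenerateChains V (n + 1) ≤ (degenerateChains V n).comap (boundary V n) := by
  refine Submodule.span_le.mpr ?_
  rintro _ ⟨x, ⟨a, b, hab, hx⟩, rfl⟩
  change boundary V n (Finsupp.single x 1) ∈ degenerateChains V n
  rw [boundary_single]
  have hne : a ≠ b := by
    intro h
    rw [h] at hab
    omega
  rw [← Finset.add_sum_erase _ _ (Finset.mem_univ a),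
    ← Finset.add_sum_erase _ _ (Finset.mem_erase.mpr ⟨hne.symm, Finset.mem_univ b⟩), ← add_assoc]
  refine Submodule.add_mem _ ?_ (Submodule.sum_mem _ fun j hj => ?_)
  · have h : a.removeNth x = b.removeNth x := by
      funext m
      simp only [Fin.removeNth]
      by_cases hm : (m : ℕ) = a
      · have h1 : a.succAbove m = b := by
          apply Fin.ext
          rw [Fin.succAbove_of_le_castSucc _ _ (by simp [Fin.le_def]; omega)]
          simp; omega
        have h2 : b.succAbove m = a := by
          apply Fin.ext
          rw [Fin.succAbove_of_castSucc_lt _ _ (by simp [Fin.lt_def]; omega)]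
          simp; omega
        rw [h1, h2, hx]
      · congr 1
        apply Fin.ext
        simp only [Fin.succAbove, Fin.lt_def, Fin.val_castSucc]
        split_ifs <;> simp <;> omega
    rw [h, ← add_smul, hab, pow_succ]
    simp
  · simp only [Finset.mem_erase, Finset.mem_univ, and_true] at hj
    refine Submodule.smul_mem _ _ (Submodule.subset_span ⟨_, ?_, rfl⟩)
    obtain ⟨a', ha'⟩ := Fin.exists_succAbove_eq (Ne.symm hj.2)
    obtain ⟨b', hb'⟩ := Fin.exists_succAbove_eq (Ne.symm hj.1)
    refine ⟨a', b', ?_, by simp only [Fin.removeNth, ha', hb', hx]⟩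
    have h1 : (j : ℕ) ≠ a := fun h => hj.2 (Fin.ext h)
    have h2 : (j : ℕ) ≠ b := fun h => hj.1 (Fin.ext h)
    have ha := congrArg Fin.val ha'
    have hb := congrArg Fin.val hb'
    simp only [Fin.succAbove, Fin.lt_def, Fin.val_castSucc] at ha hb
    split_ifs at ha hb <;> simp at ha hb <;> omega

/-- `R_{n-1} = Λ_{n-1} / I_{n-1}`: the regular chains. -/
abbrev RegularChains (V : Type u) (n : ℕ) : Type u := Chains V n ⧸ degenerateChains V n

/-- The boundary `R_n → R_{n-1}` induced on regular chains. -/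
noncomputable def regularBoundary (V : Type u) (n : ℕ) :
    RegularChains V (n + 1) →ₗ[ℤ] RegularChains V n :=
  (degenerateChains V (n + 1)).mapQ (degenerateChains V n) (boundary V n) (boundary_degenerate V n)

theorem regularBoundary_regularBoundary (V : Type u) (n : ℕ) (c : RegularChains V (n + 2)) :
    regularBoundary V n (regularBoundary V (n + 1) c) = 0 := by
  obtain ⟨c, rfl⟩ := Submodule.Quotient.mk_surjective _ c
  simp [regularBoundary, Submodule.mapQ_apply, boundary_boundary]

variable {V : Type u}

/-- A tuple is allowed in `G` if each pair of consecutive vertices is an edge of `G`. -/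
def Allowed (G : Digraph V) {n : ℕ} (x : Fin n → V) : Prop :=
  ∀ i j : Fin n, (j : ℕ) = i + 1 → G.Adj (x i) (x j)

/-- `A_{n-1}(G)`: the subgroup of `R_{n-1}` generated by the allowed tuples.  Digraphs are
understood to have no loops; a loop of `G`, if there is one, has no effect, since the tuples that
use it vanish in `R_{n-1}`. -/
noncomputable def allowedChains (G : Digraph V) (n : ℕ) : Submodule ℤ (RegularChains V n) :=
  Submodule.span ℤ {c | ∃ x : Fin n → V, Allowed G x ∧
    c = (degenerateChains V n).mkQ (Finsupp.single x 1)}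

/-- `Ω_{n-1}(G) = {c ∈ A_{n-1}(G) | ∂ c ∈ A_{n-2}(G)}`; for `n = 0` the condition is void, because
everything below the augmentation degree is zero. -/
noncomputable def invariantChains (G : Digraph V) :
    (n : ℕ) → Submodule ℤ (RegularChains V n)
  | 0 => allowedChains G 0
  | n + 1 => allowedChains G (n + 1) ⊓ (allowedChains G n).comap (regularBoundary V n)

theorem regularBoundary_mem (G : Digraph V) (n : ℕ) (c : RegularChains V (n + 1))
    (hc : c ∈ invariantChains G (n + 1)) : regularBoundary V n c ∈ invariantChains G n := by
  cases n with
  | zero => exact hc.2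
  | succ n =>
    refine ⟨hc.2, ?_⟩
    change regularBoundary V n (regularBoundary V (n + 1) c) ∈ allowedChains G n
    rw [regularBoundary_regularBoundary]
    exact Submodule.zero_mem _

/-- The boundary `Ω_n(G) → Ω_{n-1}(G)`. -/
noncomputable def invariantBoundary (G : Digraph V) (n : ℕ) :
    invariantChains G (n + 1) →ₗ[ℤ] invariantChains G n :=
  (regularBoundary V n).restrict (regularBoundary_mem G n)

/-- The augmented path complex of `G`, shifted by one: `Ω_{n-1}(G)` sits in degree `n`. -/
noncomputable def augmentedPathComplex (G : Digraph V) : ChainComplex (ModuleCat.{u} ℤ) ℕ :=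
  ChainComplex.of (fun n => ModuleCat.of ℤ (invariantChains G n))
    (fun n => ModuleCat.ofHom (invariantBoundary G n)) (by
      intro n
      ext c
      exact regularBoundary_regularBoundary V n c.1)

/-- The reduced path homology `H̃_k(G)`, with integer coefficients: the homology of the augmented
path complex at `Ω_k(G)`. -/
noncomputable def reducedPathHomology (G : Digraph V) (k : ℕ) : ModuleCat.{u} ℤ :=
  (augmentedPathComplex G).homology (k + 1)

end PathHomology

/-! Girth at least 5 rules out triangles and 4-cycles. If a walk has `x_i ≠ x_{i+2}`, deleting
`x_{i+1}` gives a regular tuple that is not allowed (no triangle) and is a face of no other walk (no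
4-cycle), so nothing can cancel it in a boundary: the walk has coefficient 0 in every invariant
chain (`coeff_eq_zero_of_mem_invariantChains`). Hence in degrees at least 1 only the paths `abab…`
along a single edge survive (`exists_eq_alternatingChain`). Their boundary keeps just the two end
faces (`regularBoundary_alternating`), so the complex splits over edges into 2-periodic pieces, in
which cycles are filled explicitly (`exists_regularBoundary_eq`). -/

theorem SimpleGraph.not_adj_of_five_le_egirth {V : Type u} {g : SimpleGraph V}
    (hg : 5 ≤ g.egirth) {a b c : V} (hab : g.Adj a b) (hbc : g.Adj b c) : ¬ g.Adj a c := by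
  intro hac
  let w : g.Walk a a := .cons hab (.cons hbc (.cons hac.symm .nil))
  have hw : w.IsCycle := by
    simp [w, SimpleGraph.Walk.isCycle_def, SimpleGraph.Walk.isTrail_def, hab.ne, hab.ne.symm,
      hbc.ne, hac.ne, hac.ne.symm]
  have h := SimpleGraph.le_egirth.mp hg a w hw
  have h' : (5 : ℕ∞) ≤ (3 : ℕ) := h
  exact absurd (by exact_mod_cast h' : 5 ≤ 3) (by norm_num)

theorem SimpleGraph.common_neighbor_unique_of_five_le_egirth {V : Type u} {g : SimpleGraph V}
    (hg : 5 ≤ g.egirth) {a b b' c : V} (hac : a ≠ c) (hab : g.Adj a b) (hbc : g.Adj b c)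
    (hab' : g.Adj a b') (hbc' : g.Adj b' c) : b = b' := by
  by_contra hne
  let w : g.Walk a a := .cons hab (.cons hbc (.cons hbc'.symm (.cons hab'.symm .nil)))
  have hw : w.IsCycle := by
    simp [w, SimpleGraph.Walk.isCycle_def, SimpleGraph.Walk.isTrail_def, hab.ne, hab.ne.symm,
      hbc.ne, hac, hac.symm, hab'.ne, hab'.ne.symm, hbc'.ne.symm, hne]
  have h := SimpleGraph.le_egirth.mp hg a w hw
  have h' : (5 : ℕ∞) ≤ (4 : ℕ) := h
  exact absurd (by exact_mod_cast h' : 5 ≤ 4) (by norm_num)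

/-! ### Coefficients of regular chains. -/

namespace PathHomology

/-- The class of an elementary path in the regular chains. -/
noncomputable def elementary {n : ℕ} (x : Fin n → V) : RegularChains V n :=
  (degenerateChains V n).mkQ (Finsupp.single x 1)

theorem elementary_eq_zero {n : ℕ} {x : Fin n → V} (hx : Degenerate x) : elementary x = 0 :=
  (Submodule.Quotient.mk_eq_zero _).mpr (Submodule.subset_span ⟨x, hx, rfl⟩)

theorem regularBoundary_elementary {n : ℕ} (x : Fin (n + 1) → V) :
    regularBoundary V n (elementary x) =
      ∑ i : Fin (n + 1), (-1 : ℤ) ^ (i : ℕ) • elementary (i.removeNth x) := by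
  change (degenerateChains V n).mkQ (boundary V n (Finsupp.single x 1)) = _
  rw [boundary_single, map_sum]
  simp only [map_smul]
  rfl

/-- The coefficient of a nondegenerate tuple in a regular chain. -/
noncomputable def coeff {n : ℕ} (x : Fin n → V) (hx : ¬ Degenerate x) :
    RegularChains V n →ₗ[ℤ] ℤ :=
  (degenerateChains V n).liftQ (Finsupp.lapply x) (by
    refine Submodule.span_le.mpr ?_
    rintro _ ⟨y, hy, rfl⟩
    have : y ≠ x := fun h => hx (h ▸ hy)
    simp [this])

open Classical in
theorem coeff_elementary {n : ℕ} (x : Fin n → V) (hx : ¬ Degenerate x) (y : Fin n → V) :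
    coeff x hx (elementary y) = if y = x then 1 else 0 := by
  change (Finsupp.single y (1 : ℤ)) x = _
  rw [Finsupp.single_apply]

theorem eq_zero_of_coeff {n : ℕ} {c : RegularChains V n}
    (h : ∀ (x : Fin n → V) (hx : ¬ Degenerate x), coeff x hx c = 0) : c = 0 := by
  obtain ⟨c, rfl⟩ := Submodule.Quotient.mk_surjective _ c
  refine (Submodule.Quotient.mk_eq_zero _).mpr ?_
  rw [← Finsupp.sum_single c]
  refine Submodule.sum_mem _ fun x hxc => ?_
  have hx : Degenerate x := by
    by_contra hx
    exact Finsupp.mem_support_iff.mp hxc (h x hx)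
  rw [← Finsupp.smul_single_one]
  exact Submodule.smul_mem _ _ (Submodule.subset_span ⟨x, hx, rfl⟩)

theorem coeff_eq_zero_of_not_allowed {G : Digraph V} {n : ℕ} {c : RegularChains V n}
    (hc : c ∈ allowedChains G n) {x : Fin n → V} (hx : ¬ Degenerate x) (hxG : ¬ Allowed G x) :
    coeff x hx c = 0 := by
  classical
  refine (Submodule.span_le (p := LinearMap.ker (coeff x hx))).mpr ?_ hc
  rintro _ ⟨y, hy, rfl⟩
  have : y ≠ x := fun h => hxG (h ▸ hy)
  exact (coeff_elementary x hx y).trans (if_neg this)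

/-! ### Alternating paths and their boundary. -/

/-- The elementary path `(a, b, a, …)` with `n` vertices. -/
def alternating (n : ℕ) (p : V × V) : Fin n → V := fun i => if Even (i : ℕ) then p.1 else p.2

theorem not_degenerate_alternating {n : ℕ} {p : V × V} (hp : p.1 ≠ p.2) :
    ¬ Degenerate (alternating n p) := by
  rintro ⟨i, j, hij, h⟩
  by_cases hi : Even (i : ℕ)
  · have hj : ¬ Even (j : ℕ) := by rw [hij]; grind
    simp only [alternating, hi, hj, if_true, if_false] at h
    exact hp h
  · have hj : Even (j : ℕ) := by rw [hij]; grind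
    simp only [alternating, hi, hj, if_true, if_false] at h
    exact hp h.symm

theorem allowed_alternating {g : SimpleGraph V} {p : V × V} (hp : g.Adj p.1 p.2) (n : ℕ) :
    Allowed g.symmDigraph (alternating n p) := by
  intro i j hij
  change g.Adj _ _
  by_cases hi : Even (i : ℕ)
  · have hj : ¬ Even (j : ℕ) := by rw [hij]; grind
    simpa only [alternating, hi, hj, if_true, if_false] using hp
  · have hj : Even (j : ℕ) := by rw [hij]; grind
    simpa only [alternating, hi, hj, if_true, if_false] using hp.symm

/-- Two vertices are needed to recover the pair; a single vertex forgets `p.2`. This is why the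
filling argument starts in degree 2. -/
theorem alternating_injective (n : ℕ) : Function.Injective (alternating (V := V) (n + 2)) := by
  intro p q h
  have h0 := congrFun h 0
  have h1 := congrFun h 1
  simp [alternating] at h0 h1
  exact Prod.ext h0 h1

theorem eq_alternating {n : ℕ} {x : Fin (n + 2) → V}
    (hx : ∀ i : Fin n, x i.castSucc.castSucc = x i.succ.succ) :
    x = alternating (n + 2) (x 0, x 1) := by
  have key : ∀ (m : ℕ) (hm : m < n + 2), x ⟨m, hm⟩ = if Even m then x 0 else x 1 := by
    intro m
    induction m using Nat.twoStepInduction with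
    | zero => intro hm; simp
    | one => intro hm; simp
    | more m ih _ =>
      intro hm
      have h := hx ⟨m, by omega⟩
      rw [show (⟨m + 2, hm⟩ : Fin (n + 2)) = Fin.succ (Fin.succ ⟨m, by omega⟩) from rfl, ← h]
      have h' := ih (by omega)
      refine Eq.trans h' ?_
      simp only [show Even (m + 2) ↔ Even m by grind]
  funext i
  exact key i i.2

/-- Deleting an interior vertex makes its two equal neighbours adjacent in the tuple, so only the
end faces are nonzero. -/
theorem regularBoundary_alternating (n : ℕ) (p : V × V) :
    regularBoundary V (n + 1) (elementary (alternating (n + 2) p)) =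
      elementary (alternating (n + 1) p.swap) +
        (-1 : ℤ) ^ (n + 1) • elementary (alternating (n + 1) p) := by
  rw [regularBoundary_elementary, Fin.sum_univ_succ, Fin.sum_univ_castSucc,
    Finset.sum_eq_zero, zero_add]
  · congr 1
    · simp only [Fin.val_zero, pow_zero, one_smul]
      congr 1
      funext i
      simp only [Fin.removeNth, alternating, Fin.zero_succAbove, Fin.val_succ, Prod.fst_swap,
        Prod.snd_swap]
      by_cases hi : Even (i : ℕ)
      · have : ¬ Even ((i : ℕ) + 1) := by grind
        simp [hi, this]
      · have : Even ((i : ℕ) + 1) := by grind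
        simp [hi, this]
    · rw [Fin.succ_last]
      simp only [Fin.val_last]
      congr 2
      funext i
      simp [Fin.removeNth, alternating]
  · intro i _
    rw [elementary_eq_zero, smul_zero]
    refine ⟨i.castSucc, i.succ, by simp, ?_⟩
    have h1 : (i.castSucc.succ).succAbove i.castSucc = i.castSucc.castSucc :=
      Fin.succAbove_of_castSucc_lt _ _ (by simp [Fin.lt_def])
    have h2 : (i.castSucc.succ).succAbove i.succ = i.succ.succ :=
      Fin.succAbove_of_le_castSucc _ _ (by simp)
    simp only [Fin.removeNth, h1, h2, alternating, Fin.val_castSucc, Fin.val_succ,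
      show Even ((i : ℕ) + 1 + 1) ↔ Even (i : ℕ) by grind]

section Finite

variable [Fintype V]

/-- The combination of alternating paths with given coefficients. -/
noncomputable def alternatingChain (n : ℕ) (φ : V × V → ℤ) : RegularChains V n :=
  ∑ p, φ p • elementary (alternating n p)

theorem regularBoundary_alternatingChain (n : ℕ) (φ : V × V → ℤ) :
    regularBoundary V (n + 1) (alternatingChain (n + 2) φ) =
      alternatingChain (n + 1) (fun p => φ p.swap + (-1) ^ (n + 1) * φ p) := by
  simp only [alternatingChain, map_sum, map_smul, regularBoundary_alternating, smul_add, add_smul,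
    Finset.sum_add_distrib]
  congr 1
  · exact Fintype.sum_equiv (Equiv.prodComm V V) _ _ fun p => by simp
  · refine Finset.sum_congr rfl fun p _ => ?_
    rw [smul_smul, mul_comm]

theorem coeff_alternatingChain {n : ℕ} (φ : V × V → ℤ) {p : V × V}
    (hp : ¬ Degenerate (alternating (n + 2) p)) :
    coeff _ hp (alternatingChain (n + 2) φ) = φ p := by
  classical
  simp [alternatingChain, coeff_elementary, (alternating_injective n).eq_iff]

theorem coeff_alternatingChain_of_ne {n : ℕ} (φ : V × V → ℤ) {x : Fin n → V}
    (hx : ¬ Degenerate x) (h : ∀ p, alternating n p ≠ x) :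
    coeff x hx (alternatingChain n φ) = 0 := by
  classical
  simp [alternatingChain, coeff_elementary, h]

theorem alternatingChain_mem_allowedChains {g : SimpleGraph V} {φ : V × V → ℤ}
    (hφ : ∀ p, ¬ g.Adj p.1 p.2 → φ p = 0) (n : ℕ) :
    alternatingChain n φ ∈ allowedChains g.symmDigraph n := by
  refine Submodule.sum_mem _ fun p _ => ?_
  by_cases hp : g.Adj p.1 p.2
  · exact Submodule.smul_mem _ _ (Submodule.subset_span ⟨_, allowed_alternating hp n, rfl⟩)
  · rw [hφ p hp, zero_smul]
    exact Submodule.zero_mem _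

end Finite

/-! ### Invariant chains are combinations of alternating paths. -/

/-- In a graph of girth at least five, a tuple obtained from a walk by deleting an interior vertex
between two distinct vertices arises from no other walk by deleting a vertex. -/
theorem eq_of_removeNth_eq {g : SimpleGraph V} (hg : 5 ≤ g.egirth) {n : ℕ} {x z : Fin (n + 2) → V}
    (hx : Allowed g.symmDigraph x) (hz : Allowed g.symmDigraph z) (i : Fin n)
    (hi : x i.castSucc.castSucc ≠ x i.succ.succ) (j : Fin (n + 2))
    (h : j.removeNth z = i.castSucc.succ.removeNth x) : j = i.castSucc.succ ∧ z = x := by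
  have hx1 : g.Adj (x i.castSucc.castSucc) (x i.castSucc.succ) := hx _ _ (by simp)
  have hx2 : g.Adj (x i.castSucc.succ) (x i.succ.succ) := hx _ _ (by simp)
  have h1 : (i.castSucc.succ).succAbove i.castSucc = i.castSucc.castSucc :=
    Fin.succAbove_of_castSucc_lt _ _ (by simp [Fin.lt_def])
  have h2 : (i.castSucc.succ).succAbove i.succ = i.succ.succ :=
    Fin.succAbove_of_le_castSucc _ _ (by simp)
  have e1 := congrFun h i.castSucc
  have e2 := congrFun h i.succ
  simp only [Fin.removeNth, h1, h2] at e1 e2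
  -- Any other deletion would leave the two ends of the gap consecutive in the walk `z`, closing a
  -- triangle.
  have hj : j = i.castSucc.succ := by
    by_contra hne
    have hz' := hz (j.succAbove i.castSucc) (j.succAbove i.succ) (by
      have hne' : (j : ℕ) ≠ i + 1 := fun h => hne (Fin.ext (by simpa using h))
      simp only [Fin.succAbove, Fin.lt_def, Fin.val_castSucc, Fin.val_succ]
      split_ifs <;> simp <;> omega)
    rw [e1, e2] at hz'
    exact SimpleGraph.not_adj_of_five_le_egirth hg hx1 hx2 hz'
  refine ⟨hj, ?_⟩
  subst hj
  rw [h1] at e1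
  rw [h2] at e2
  have hz1 : g.Adj (z i.castSucc.castSucc) (z i.castSucc.succ) := hz _ _ (by simp)
  have hz2 : g.Adj (z i.castSucc.succ) (z i.succ.succ) := hz _ _ (by simp)
  rw [e1] at hz1
  rw [e2] at hz2
  have e3 := SimpleGraph.common_neighbor_unique_of_five_le_egirth hg hi hz1 hz2 hx1 hx2
  funext m
  rcases eq_or_ne m i.castSucc.succ with rfl | hm
  · exact e3
  · obtain ⟨m', rfl⟩ := Fin.exists_succAbove_eq hm
    exact congrFun h m'

theorem coeff_eq_zero_of_mem_invariantChains {g : SimpleGraph V} (hg : 5 ≤ g.egirth) {n : ℕ}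
    {c : RegularChains V (n + 2)} (hc : c ∈ invariantChains g.symmDigraph (n + 2))
    {x : Fin (n + 2) → V} (hx : ¬ Degenerate x) (hxG : Allowed g.symmDigraph x) (i : Fin n)
    (hi : x i.castSucc.castSucc ≠ x i.succ.succ) : coeff x hx c = 0 := by
  classical
  have h1 : (i.castSucc.succ).succAbove i.castSucc = i.castSucc.castSucc :=
    Fin.succAbove_of_castSucc_lt _ _ (by simp [Fin.lt_def])
  have h2 : (i.castSucc.succ).succAbove i.succ = i.succ.succ :=
    Fin.succAbove_of_le_castSucc _ _ (by simp)
  set y := i.castSucc.succ.removeNth x with hy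
  have hyd : ¬ Degenerate y := by
    rintro ⟨a, b, hab, h⟩
    by_cases ha : a = i.castSucc
    · obtain rfl : b = i.succ := Fin.ext (by simp [hab, ha])
      subst ha
      simp only [hy, Fin.removeNth, h1, h2] at h
      exact hi h
    · refine hx ⟨_, _, ?_, h⟩
      have ha' : (a : ℕ) ≠ i := fun h => ha (Fin.ext (by simpa using h))
      simp only [Fin.succAbove, Fin.lt_def, Fin.val_castSucc, Fin.val_succ]
      split_ifs <;> simp <;> omega
  have hyG : ¬ Allowed g.symmDigraph y := by
    intro h
    have h' := h i.castSucc i.succ (by simp)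
    simp only [hy, Fin.removeNth, h1, h2] at h'
    exact SimpleGraph.not_adj_of_five_le_egirth hg (hxG _ i.castSucc.succ (by simp))
      (hxG i.castSucc.succ _ (by simp)) h'
  -- On allowed chains the coefficient of the face `y` in the boundary is, up to sign, the
  -- coefficient of `x`; it suffices to check this on generators.
  have key : Set.EqOn (coeff y hyd ∘ₗ regularBoundary V (n + 1))
      ((-1 : ℤ) ^ ((i.castSucc.succ : Fin (n + 2)) : ℕ) • coeff x hx : RegularChains V (n + 2) →ₗ[ℤ] ℤ)
      {c | ∃ x : Fin (n + 2) → V, Allowed g.symmDigraph x ∧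
        c = (degenerateChains V (n + 2)).mkQ (Finsupp.single x 1)} := by
    rintro _ ⟨z, hz, rfl⟩
    change coeff y hyd (regularBoundary V (n + 1) (elementary z)) =
      (-1 : ℤ) ^ ((i.castSucc.succ : Fin (n + 2)) : ℕ) • coeff x hx (elementary z)
    rw [regularBoundary_elementary, map_sum, Finset.sum_eq_single i.castSucc.succ]
    · rw [map_smul, coeff_elementary, coeff_elementary]
      congr 2
      exact propext ⟨fun h => (eq_of_removeNth_eq hg hxG hz i hi _ h).2, fun h => h ▸ rfl⟩
    · intro j _ hj
      rw [map_smul, coeff_elementary, if_neg, smul_zero]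
      exact fun h => hj (eq_of_removeNth_eq hg hxG hz i hi _ h).1
    · simp
  have h := LinearMap.eqOn_span key hc.1
  have h0 : coeff y hyd (regularBoundary V (n + 1) c) = 0 :=
    coeff_eq_zero_of_not_allowed hc.2 hyd hyG
  rw [LinearMap.comp_apply, h0] at h
  simpa using h.symm

theorem exists_eq_alternatingChain [Fintype V] {g : SimpleGraph V} (hg : 5 ≤ g.egirth) {n : ℕ}
    {c : RegularChains V (n + 2)} (hc : c ∈ invariantChains g.symmDigraph (n + 2)) :
    ∃ φ : V × V → ℤ, (∀ p, ¬ g.Adj p.1 p.2 → φ p = 0) ∧ c = alternatingChain (n + 2) φ := by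
  classical
  let φ : V × V → ℤ := fun p => if h : g.Adj p.1 p.2 then
    coeff (alternating (n + 2) p) (not_degenerate_alternating h.ne) c else 0
  refine ⟨φ, fun p hp => dif_neg hp, ?_⟩
  rw [← sub_eq_zero]
  refine eq_zero_of_coeff fun x hx => ?_
  rw [map_sub, sub_eq_zero]
  by_cases hxG : Allowed g.symmDigraph x
  · by_cases hi : ∀ i : Fin n, x i.castSucc.castSucc = x i.succ.succ
    · have hadj : g.Adj (x 0, x 1).1 (x 0, x 1).2 := hxG 0 1 (by simp)
      have hp := eq_alternating hi
      generalize (x 0, x 1) = p at hp hadj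
      subst hp
      rw [coeff_alternatingChain]
      exact (dif_pos hadj : φ p = _).symm
    · push Not at hi
      obtain ⟨i, hi⟩ := hi
      rw [coeff_eq_zero_of_mem_invariantChains hg hc hx hxG i hi, coeff_alternatingChain_of_ne]
      rintro p rfl
      apply hi
      simp only [alternating, Fin.val_castSucc, Fin.val_succ,
        show Even ((i : ℕ) + 1 + 1) ↔ Even (i : ℕ) by grind]
  · rw [coeff_eq_zero_of_not_allowed hc.1 hx hxG,
      coeff_eq_zero_of_not_allowed
        (alternatingChain_mem_allowedChains (fun p hp => dif_neg hp) _) hx hxG]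

/-! ### Filling cycles. -/

theorem exists_regularBoundary_eq [Fintype V] {g : SimpleGraph V} (hg : 5 ≤ g.egirth) {n : ℕ}
    {c : RegularChains V (n + 3)} (hc : c ∈ invariantChains g.symmDigraph (n + 3))
    (hc0 : regularBoundary V (n + 2) c = 0) :
    ∃ d ∈ invariantChains g.symmDigraph (n + 4), regularBoundary V (n + 3) d = c := by
  classical
  obtain ⟨φ, hφ, rfl⟩ := exists_eq_alternatingChain hg hc
  have hcycle : ∀ p : V × V, p.1 ≠ p.2 → φ p.swap + (-1) ^ (n + 2) * φ p = 0 := by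
    intro p hp
    rw [regularBoundary_alternatingChain] at hc0
    have h := coeff_alternatingChain (n := n)
      (fun p => φ p.swap + (-1) ^ (n + 2) * φ p) (not_degenerate_alternating hp)
    rw [← h, hc0, map_zero]
  -- An arbitrary order selects one orientation of each edge. With `ψ` supported there, the first
  -- end face gives `φ` on one orientation, and the cycle relation makes the last end face give `φ`
  -- on the other.
  let _ : LinearOrder V := linearOrderOfSTO (WellOrderingRel (α := V))
  let ψ : V × V → ℤ := fun p => if p.2 < p.1 then φ p.swap else 0
  have hψ : ∀ p, ¬ g.Adj p.1 p.2 → ψ p = 0 := by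
    intro p hp
    simp only [ψ]
    rw [hφ _ (fun h => hp h.symm), ite_self]
  have hd : regularBoundary V (n + 3) (alternatingChain (n + 4) ψ) = alternatingChain (n + 3) φ := by
    rw [regularBoundary_alternatingChain]
    congr 1
    funext p
    rcases lt_trichotomy p.1 p.2 with h | h | h
    · simp [ψ, h, h.not_gt]
    · simp [ψ, h, hφ p (fun h' => h'.ne h)]
    · have hp := hcycle p h.ne'
      simp only [ψ, Prod.fst_swap, Prod.snd_swap, h, h.not_gt, if_true, if_false]
      have hs : ((-1 : ℤ) ^ (n + 2)) * (-1) ^ (n + 2) = 1 := by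
        rw [← mul_pow]; simp
      rw [pow_succ]
      linear_combination (-(-1) ^ (n + 2)) * hp + φ p * hs
  refine ⟨alternatingChain (n + 4) ψ, ⟨alternatingChain_mem_allowedChains hψ _, ?_⟩, hd⟩
  change regularBoundary V (n + 3) _ ∈ allowedChains g.symmDigraph (n + 3)
  rw [hd]
  exact hc.1

end PathHomology

theorem mainTheorem5 {V : Type u} [Finite V] (g : SimpleGraph V) (hg : 5 ≤ g.egirth)
    (k : ℕ) (hk : 2 ≤ k) :
    CategoryTheory.Limits.IsZero (PathHomology.reducedPathHomology g.symmDigraph k) := by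
  obtain ⟨n, rfl⟩ := Nat.exists_eq_add_of_le' hk
  have := Fintype.ofFinite V
  refine (HomologicalComplex.exactAt_iff_isZero_homology _ _).mp ?_
  -- Here `k = n + 2`, and the complex is indexed by the number of vertices, so the middle term is
  -- `n + 3`.
  rw [HomologicalComplex.exactAt_iff' _ (n + 4) (n + 3) (n + 2) (by simp) (by simp),
    CategoryTheory.ShortComplex.moduleCat_exact_iff]
  intro c hc
  have hd (m : ℕ) : (PathHomology.augmentedPathComplex g.symmDigraph).d (m + 1) m =
      ModuleCat.ofHom (PathHomology.invariantBoundary g.symmDigraph m) :=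
    ChainComplex.of_d (V := ModuleCat.{u} ℤ)
      (fun n => ModuleCat.of ℤ (PathHomology.invariantChains g.symmDigraph n))
      (fun n => ModuleCat.ofHom (PathHomology.invariantBoundary g.symmDigraph n)) m
  replace hc : (PathHomology.augmentedPathComplex g.symmDigraph).d (n + 3) (n + 2) c = 0 := hc
  change ∃ b, (PathHomology.augmentedPathComplex g.symmDigraph).d (n + 4) (n + 3) b = c
  rw [hd] at hc ⊢
  obtain ⟨d, hd, hdc⟩ := PathHomology.exists_regularBoundary_eq hg c.2 (congrArg Subtype.val hc)
  exact ⟨⟨d, hd⟩, Subtype.ext hdc⟩
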